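/- **Setup.** Let $n\ge 1$. Regard $S_n$ as the group of bijections of $\mathbb{Z}/n\mathbb{Z}$ (with $n$ identified with $0$), let $a$ be the standard $n$-cycle $u\mapsto u+1$, let $C_n=\langle a\rangle$, and let $S_{n-1}$ be the subgroup of permutations fixing $n$. Every element of $S_n$ is uniquely a product of an element of $C_n$ and an element of $S_{n-1}$. For $x\in S_{n-1}$ and $b\in C_n$ define $x\rhd b\in C_n$ and $x\lhd b\in S_{n-1}$ by $xb=(x\rhd b)(x\lhd b)$, and put $F_x=\{b\in C_n : x\lhd b=x\}$ and $\mathcal{O}_x=\{x\lhd b : b\in C_n\}$. Let $J_n=\mathbb{C}^{S_{n-1}}\#\mathbb{C}C_n$ be the bismash product Hopf algebra: it has basis $p_x\#b$ ($x\in S_{n-1}$, $b\in C_n$), unit $\sum_y p_y\#1$, and structure maps $$(p_x\#b)(p_y\#c)=\delta_{y,\,x\lhd b}\;p_x\#bc,\qquad \varepsilon(p_x\#b)=\delta_{x,1},$$ $$\Delta(p_x\#b)=\sum_{y\in S_{n-1}}\bigl(p_{xy^{-1}}\#(y\rhd b)\bigr)\otimes(p_y\#b),\qquad S(p_x\#b)=p_{(x\lhd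 b)^{-1}}\#(x\rhd b)^{-1}.$$ For a character $\chi$ of $J_n$, its (second) Frobenius–Schur indicator is $\nu(\chi)=\chi\bigl(\sum\Lambda_1\Lambda_2\bigr)$, where $\Lambda\in J_n$ is the two-sided integral normalized by $\varepsilon(\Lambda)=1$ and $\Delta(\Lambda)=\sum\Lambda_1\otimes\Lambda_2$. If $V$ is a representation of $F_x$ with character $\chi$, let $\hat\chi$ be the character of the induced $J_n$-module $\hat V=\mathbb{C}C_n\otimes_{\mathbb{C}F_x}V$, on which $(p_y\#b)\cdot(c\otimes v)=\delta_{y\lhd(bc),\,x}\,(bc\otimes v)$. **Theorem.** Let $x\in S_{n-1}$ with $F_x=\langle a^t\rangle$, where $t\ge 1$ divides $n$, and suppose that $x^{-1}\in\mathcal{O}_x$, say $x^{-1}=x\lhd a^s$ with $s\in\mathbb{Z}$. Then there are integers $u_1,u_2$ with $$x(t)+t\equiv u_1t \pmod n,\qquad x(s)+s\equiv u_2t\pmod n .$$ Let $u_1,u_2$ be any such integers, let $\zeta_{n/t}\in\mathbb{C}$ be a primitive $\frac nt$-th root of unity, let $i\in\mathbb{Z}$, and let $\chi_{x,i}$ be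 the character of the one-dimensional representation $\rho_{x,i}:F_x\to\mathbb{C}^\times$ with $\rho_{x,i}(a^t)=\zeta_{n/t}^{\,i}$. Then: 1. if $\frac nt$ is odd, then $$\nu(\hat\chi_{x,i})=\begin{cases}1&\text{if }\zeta_{n/t}^{\,iu_1}=1,\\ 0&\text{if }\zeta_{n/t}^{\,iu_1}\neq1;\end{cases}$$ 2. if $\frac nt$ is even, then $$\nu(\hat\chi_{x,i})=\begin{cases}\zeta_{n/t}^{\,-iu_2}&\text{if }\zeta_{n/t}^{\,iu_1}=1,\\ 0&\text{if }\zeta_{n/t}^{\,iu_1}\neq1,\end{cases}$$ and in the first case $\zeta_{n/t}^{\,-iu_2}\in\{1,-1\}$. -/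

import Mathlib

open scoped TensorProduct

/-! ### Matched pairs of groups and factorizable groups -/

/-- A matched pair of groups: a left action `x ▷ a` (`lact`) of `G` on the set `F` and a right
action `x ◁ a` (`ract`) of `F` on the set `G`, subject to the two compatibility conditions. -/
structure MatchedPair (F G : Type*) [Group F] [Group G] where
  lact : G → F → F
  ract : G → F → G
  one_lact : ∀ a, lact 1 a = a
  mul_lact : ∀ x y a, lact (x * y) a = lact x (lact y a)
  ract_one : ∀ x, ract x 1 = x
  ract_mul : ∀ x a b, ract x (a * b) = ract (ract x a) b
  lact_mul : ∀ x a b, lact x (a * b) = lact x a * lact (ract x a) b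
  mul_ract : ∀ x y a, ract (x * y) a = ract x (lact y a) * ract y a

namespace MatchedPair

variable {F G : Type*} [Group F] [Group G] (P : MatchedPair F G)

theorem lact_one (x : G) : P.lact x 1 = 1 := by
  have h := P.lact_mul x 1 1
  rw [P.ract_one, mul_one] at h
  exact left_eq_mul.mp h

theorem one_ract (a : F) : P.ract 1 a = 1 := by
  have h := P.mul_ract 1 1 a
  rw [P.one_lact, mul_one] at h
  exact left_eq_mul.mp h

theorem ract_inv (x : G) (a : F) : (P.ract x a)⁻¹ = P.ract x⁻¹ (P.lact x a) := by
  have h := P.mul_ract x⁻¹ x a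
  rw [inv_mul_cancel, P.one_ract] at h
  exact inv_eq_of_mul_eq_one_left h.symm

theorem lact_inv (x : G) (a : F) : (P.lact x a)⁻¹ = P.lact (P.ract x a) a⁻¹ := by
  have h := P.lact_mul x a a⁻¹
  rw [mul_inv_cancel, P.lact_one] at h
  exact (mul_eq_one_iff_inv_eq.mp h.symm)

theorem ract_ract_inv (x : G) (a : F) : P.ract (P.ract x a) a⁻¹ = x := by
  rw [← P.ract_mul, mul_inv_cancel, P.ract_one]

theorem ract_inv_ract (x : G) (a : F) : P.ract (P.ract x a⁻¹) a = x := by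
  rw [← P.ract_mul, inv_mul_cancel, P.ract_one]

/-- Acting by `a` is a permutation of `G`. -/
def ractEquiv (a : F) : G ≃ G where
  toFun x := P.ract x a
  invFun x := P.ract x a⁻¹
  left_inv x := P.ract_ract_inv x a
  right_inv x := P.ract_inv_ract x a

/-- The stabilizer `F_x = {a ∈ F | x ◁ a = x}`. -/
def stab (x : G) : Subgroup F where
  carrier := {a | P.ract x a = x}
  mul_mem' := by
    intro a b ha hb
    simp only [Set.mem_ofPred_eq] at *
    rw [P.ract_mul, ha, hb]
  one_mem' := P.ract_one x
  inv_mem' := by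
    intro a ha
    simp only [Set.mem_ofPred_eq] at *
    conv_lhs => rw [← ha]
    exact P.ract_ract_inv x a

theorem mem_stab {x : G} {a : F} : a ∈ P.stab x ↔ P.ract x a = x := Iff.rfl

/-- The matched pair of a factorizable group `L = FG`, `F ∩ G = 1`: for `x ∈ G` and `b ∈ F` the
elements `x ▷ b ∈ F` and `x ◁ b ∈ G` are the unique ones with `x b = (x ▷ b) (x ◁ b)`. -/
noncomputable def ofFactorization {L : Type*} [Group L] (F G : Subgroup L)
    (h : F.IsComplement' G) : MatchedPair F G :=
  have key : ∀ (f f' : F) (g g' : G), (f : L) * g = f' * g' → f = f' ∧ g = g' := by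
    intro f f' g g' e
    have := h.injective (a₁ := (f, g)) (a₂ := (f', g')) e
    exact ⟨congrArg Prod.fst this, congrArg Prod.snd this⟩
  let l : G → F → F := fun x b => (Subgroup.IsComplement.equiv h ((x : L) * b)).1
  let r : G → F → G := fun x b => (Subgroup.IsComplement.equiv h ((x : L) * b)).2
  have spec : ∀ x b, (l x b : L) * (r x b : L) = (x : L) * b := fun x b =>
    Subgroup.IsComplement.equiv_fst_mul_equiv_snd h _
  have hone : ∀ a, l 1 a = a := fun a => (key (l 1 a) a (r 1 a) 1 (by rw [spec]; simp)).1
  have hone' : ∀ x, r x 1 = x := fun x => (key (l x 1) 1 (r x 1) x (by rw [spec]; simp)).2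
  have hG : ∀ x y a, l (x * y) a = l x (l y a) ∧ r (x * y) a = r x (l y a) * r y a := by
    intro x y a
    refine key _ _ _ _ ?_
    rw [spec, Subgroup.coe_mul, Subgroup.coe_mul, ← mul_assoc, spec x (l y a), mul_assoc, mul_assoc,
      spec y a]
  have hF : ∀ x a b, l x (a * b) = l x a * l (r x a) b ∧ r x (a * b) = r (r x a) b := by
    intro x a b
    refine key _ _ _ _ ?_
    rw [spec, Subgroup.coe_mul, Subgroup.coe_mul, mul_assoc, spec (r x a) b, ← mul_assoc,
      ← mul_assoc, spec x a]
  { lact := l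
    ract := r
    one_lact := hone
    mul_lact := fun x y a => (hG x y a).1
    ract_one := hone'
    ract_mul := fun x a b => (hF x a b).2
    lact_mul := fun x a b => (hF x a b).1
    mul_ract := fun x y a => (hG x y a).2 }

theorem ofFactorization_spec {L : Type*} [Group L] (F G : Subgroup L)
    (h : F.IsComplement' G) (x : G) (b : F) :
    (((ofFactorization F G h).lact x b : F) : L) * (((ofFactorization F G h).ract x b : G) : L)
      = (x : L) * b :=
  Subgroup.IsComplement.equiv_fst_mul_equiv_snd h _

end MatchedPair

/-! ### The bismash product Hopf algebra `k^G # kF` -/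

/-- The underlying space of the bismash product `k^G # kF` of a matched pair of finite groups:
the `k`-vector space with basis the elements `p_x # a`, for `x ∈ G` and `a ∈ F`. -/
def Bismash (k : Type*) [CommRing k] {F G : Type*} [Group F] [Group G] (_P : MatchedPair F G) :
    Type _ :=
  G × F →₀ k

namespace Bismash

variable {k : Type*} [CommRing k] {F G : Type*} [Group F] [Group G] {P : MatchedPair F G}

noncomputable instance : AddCommGroup (Bismash k P) :=
  inferInstanceAs (AddCommGroup (G × F →₀ k))

noncomputable instance : Module k (Bismash k P) :=
  inferInstanceAs (Module k (G × F →₀ k))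

variable (k P) in
/-- The basis element `p_x # a`. -/
noncomputable def p (x : G) (a : F) : Bismash k P := Finsupp.single (x, a) (1 : k)

variable (k P) in
/-- The linear map on `k^G # kF` with prescribed values on the basis `p_x # a`. -/
noncomputable def lift {M : Type*} [AddCommGroup M] [Module k M] (f : G → F → M) :
    Bismash k P →ₗ[k] M :=
  Finsupp.linearCombination k (fun q : G × F => f q.1 q.2)

@[simp] theorem lift_p {M : Type*} [AddCommGroup M] [Module k M] (f : G → F → M) (x : G) (a : F) :
    lift k P f (p k P x a) = f x a :=
  (Finsupp.linearCombination_single k (1 : k) (x, a)).trans (one_smul k _)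

theorem lhom_ext {M : Type*} [AddCommGroup M] [Module k M] {f g : Bismash k P →ₗ[k] M}
    (h : ∀ x a, f (p k P x a) = g (p k P x a)) : f = g := by
  refine Finsupp.lhom_ext' (σ₁₂ := RingHom.id k) (φ := f) (ψ := g) fun q => ?_
  refine LinearMap.ext_ring ?_
  exact h q.1 q.2

open Classical in
variable (k P) in
/-- Multiplication: `(p_x # a)(p_y # b) = δ_{y, x ◁ a} p_x # ab`. -/
noncomputable def mulMap : Bismash k P →ₗ[k] Bismash k P →ₗ[k] Bismash k P :=
  lift k P fun x a => lift k P fun y b => if y = P.ract x a then p k P x (a * b) else 0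

open Classical in
theorem mulMap_p (x y : G) (a b : F) :
    mulMap k P (p k P x a) (p k P y b) = if y = P.ract x a then p k P x (a * b) else 0 := by
  simp [mulMap]

theorem mulMap_assoc (u v w : Bismash k P) :
    mulMap k P (mulMap k P u v) w = mulMap k P u (mulMap k P v w) := by
  have h : (mulMap k P).compr₂ (mulMap k P)
      = LinearMap.compl₁₂ (LinearMap.llcomp k (Bismash k P) (Bismash k P) (Bismash k P))
        (mulMap k P) (mulMap k P) := by
    refine lhom_ext fun x a => lhom_ext fun y b => lhom_ext fun z c => ?_
    simp only [LinearMap.compr₂_apply, LinearMap.compl₁₂_apply, LinearMap.llcomp_apply, mulMap_p]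
    by_cases h1 : y = P.ract x a
    · subst h1
      rw [if_pos rfl, mulMap_p]
      by_cases h2 : z = P.ract (P.ract x a) b
      · rw [if_pos h2, if_pos (by rw [P.ract_mul, h2]), mulMap_p, if_pos rfl, mul_assoc]
      · rw [if_neg h2, if_neg (by rwa [P.ract_mul]), map_zero]
    · simp only [if_neg h1, map_zero, LinearMap.zero_apply]
      split_ifs <;> simp [mulMap_p, h1]
  exact congrArg (fun f => f u v w) h

variable [Fintype G]

/-- The unit is `1 # 1 = ∑ y, p_y # 1`. -/
noncomputable instance instRing : Ring (Bismash k P) :=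
  { (inferInstance : AddCommGroup (Bismash k P)) with
    mul := fun u v => mulMap k P u v
    one := ∑ y : G, p k P y 1
    mul_assoc := mulMap_assoc
    left_distrib := fun u v w => map_add (mulMap k P u) v w
    right_distrib := fun u v w => by
      change mulMap k P (u + v) w = mulMap k P u w + mulMap k P v w
      rw [map_add, LinearMap.add_apply]
    zero_mul := fun u => by
      change mulMap k P 0 u = 0
      rw [map_zero, LinearMap.zero_apply]
    mul_zero := fun u => map_zero (mulMap k P u)
    one_mul := fun u => by
      change mulMap k P (∑ y : G, p k P y 1) u = u
      have h : mulMap k P (∑ y : G, p k P y 1) = LinearMap.id := by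
        refine lhom_ext fun x a => ?_
        rw [map_sum, LinearMap.sum_apply, Finset.sum_eq_single x, mulMap_p, P.ract_one, if_pos rfl,
          one_mul, LinearMap.id_apply]
        · intro y _ hy
          rw [mulMap_p, P.ract_one, if_neg hy.symm]
        · simp
      rw [h, LinearMap.id_apply]
    mul_one := fun u => by
      change mulMap k P u (∑ y : G, p k P y 1) = u
      have h : (mulMap k P).flip (∑ y : G, p k P y 1) = LinearMap.id := by
        refine lhom_ext fun x a => ?_
        rw [map_sum, LinearMap.sum_apply, Finset.sum_eq_single (P.ract x a), LinearMap.flip_apply,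
          mulMap_p, if_pos rfl, mul_one, LinearMap.id_apply]
        · intro y _ hy
          rw [LinearMap.flip_apply, mulMap_p, if_neg hy]
        · simp
      exact congrArg (fun f => f u) h }

theorem mul_def (u v : Bismash k P) : u * v = mulMap k P u v := rfl

theorem one_def : (1 : Bismash k P) = ∑ y : G, p k P y 1 := rfl

open Classical in
theorem p_mul_p (x y : G) (a b : F) :
    p k P x a * p k P y b = if y = P.ract x a then p k P x (a * b) else 0 :=
  mulMap_p x y a b

noncomputable instance instAlgebra : Algebra k (Bismash k P) :=
  Algebra.ofModule
    (fun r u v => by rw [mul_def, mul_def, map_smul, LinearMap.smul_apply])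
    (fun r u v => by rw [mul_def, mul_def, map_smul])

open Classical in
/-- Counit `ε(p_x # a) = δ_{x, 1}` and comultiplication
`Δ(p_x # a) = ∑ y, (p_{x y⁻¹} # (y ▷ a)) ⊗ (p_y # a)`. -/
noncomputable instance instCoalgebraStruct : CoalgebraStruct k (Bismash k P) where
  comul := lift k P fun x a => ∑ y : G, p k P (x * y⁻¹) (P.lact y a) ⊗ₜ[k] p k P y a
  counit := lift k P fun x _ => if x = 1 then 1 else 0

theorem comul_p (x : G) (a : F) : CoalgebraStruct.comul (R := k) (p k P x a)
    = ∑ y : G, p k P (x * y⁻¹) (P.lact y a) ⊗ₜ[k] p k P y a :=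
  lift_p _ x a

open Classical in
theorem counit_p (x : G) (a : F) :
    CoalgebraStruct.counit (R := k) (p k P x a) = if x = 1 then (1 : k) else 0 :=
  lift_p _ x a

noncomputable instance instCoalgebra : Coalgebra k (Bismash k P) where
  coassoc := by
    refine lhom_ext fun x a => ?_
    simp only [LinearMap.comp_apply, comul_p, map_sum, LinearMap.rTensor_tmul,
      LinearMap.lTensor_tmul, TensorProduct.sum_tmul, TensorProduct.tmul_sum,
      LinearEquiv.coe_coe, TensorProduct.assoc_tmul, ← P.mul_lact]
    conv_rhs => rw [Finset.sum_comm]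
    refine Finset.sum_congr rfl fun w _ => ?_
    refine Fintype.sum_equiv (Equiv.mulRight w) _ _ fun z => ?_
    simp [mul_assoc]
  rTensor_counit_comp_comul := by
    classical
    refine lhom_ext fun x a => ?_
    simp only [LinearMap.comp_apply, comul_p, map_sum, LinearMap.rTensor_tmul, counit_p,
      mul_inv_eq_one]
    rw [Finset.sum_eq_single x]
    · simp
    · intro y _ hy
      simp [Ne.symm hy]
    · simp
  lTensor_counit_comp_comul := by
    classical
    refine lhom_ext fun x a => ?_
    simp only [LinearMap.comp_apply, comul_p, map_sum, LinearMap.lTensor_tmul, counit_p]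
    rw [Finset.sum_eq_single 1]
    · simp [P.one_lact]
    · intro y _ hy
      simp [hy]
    · simp

theorem counit_one' : CoalgebraStruct.counit (R := k) (1 : Bismash k P) = 1 := by
  classical
  simp [one_def, counit_p]

theorem counit_mul' (u v : Bismash k P) : CoalgebraStruct.counit (R := k) (u * v)
    = CoalgebraStruct.counit (R := k) u * CoalgebraStruct.counit (R := k) v := by
  classical
  have h : (mulMap k P).compr₂ (CoalgebraStruct.counit (R := k))
      = (LinearMap.mul k k).compl₁₂ (CoalgebraStruct.counit (R := k))
        (CoalgebraStruct.counit (R := k)) := by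
    refine lhom_ext fun x a => lhom_ext fun y b => ?_
    simp only [LinearMap.compr₂_apply, LinearMap.compl₁₂_apply, mulMap_p, counit_p,
      LinearMap.mul_apply']
    by_cases hx : x = 1
    · subst hx
      rw [P.one_ract]
      split_ifs <;> simp_all [counit_p]
    · split_ifs <;> simp [counit_p, hx]
  exact congrArg (fun f => f u v) h

theorem comul_one' : CoalgebraStruct.comul (R := k) (1 : Bismash k P) = 1 := by
  rw [Algebra.TensorProduct.one_def]
  simp only [one_def, map_sum, comul_p, P.lact_one, TensorProduct.sum_tmul, TensorProduct.tmul_sum]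
  rw [Finset.sum_comm]
  refine Finset.sum_congr rfl fun y _ => ?_
  exact Fintype.sum_equiv (Equiv.mulRight y⁻¹) _ _ fun x => rfl

theorem comul_mul' (u v : Bismash k P) : CoalgebraStruct.comul (R := k) (u * v)
    = CoalgebraStruct.comul (R := k) u * CoalgebraStruct.comul (R := k) v := by
  classical
  have h : (mulMap k P).compr₂ (CoalgebraStruct.comul (R := k))
      = (LinearMap.mul k (Bismash k P ⊗[k] Bismash k P)).compl₁₂ (CoalgebraStruct.comul (R := k))
        (CoalgebraStruct.comul (R := k)) := by
    refine lhom_ext fun x a => lhom_ext fun z b => ?_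
    simp only [LinearMap.compr₂_apply, LinearMap.compl₁₂_apply, mulMap_p, comul_p,
      LinearMap.mul_apply', Finset.sum_mul_sum, Algebra.TensorProduct.tmul_mul_tmul, p_mul_p]
    have inner : ∀ y : G, ∑ w : G, (if z * w⁻¹ = P.ract (x * y⁻¹) (P.lact y a) then
          p k P (x * y⁻¹) (P.lact y a * P.lact w b) else 0) ⊗ₜ[k]
          (if w = P.ract y a then p k P y (a * b) else 0)
        = if z = P.ract x a then
          p k P (x * y⁻¹) (P.lact y (a * b)) ⊗ₜ[k] p k P y (a * b) else 0 := by
      intro y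
      rw [Finset.sum_eq_single (P.ract y a)]
      · have e : P.ract x a = P.ract (x * y⁻¹) (P.lact y a) * P.ract y a := by
          rw [← P.mul_ract, inv_mul_cancel_right]
        rw [if_pos rfl, P.lact_mul, e, mul_inv_eq_iff_eq_mul]
        split_ifs <;> simp
      · intro w _ hw
        rw [if_neg hw, TensorProduct.tmul_zero]
      · simp
    rw [Finset.sum_congr rfl fun y _ => inner y]
    split_ifs <;> simp [comul_p]
  exact congrArg (fun f => f u v) h

noncomputable instance instBialgebra : Bialgebra k (Bismash k P) :=
  Bialgebra.mk' k (Bismash k P) counit_one' (counit_mul' _ _) comul_one' (comul_mul' _ _)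

/-- The antipode is `S(p_x # a) = p_{(x ◁ a)⁻¹} # (x ▷ a)⁻¹`. -/
noncomputable instance instHopfAlgebra : HopfAlgebra k (Bismash k P) where
  antipode := lift k P fun x a => p k P (P.ract x a)⁻¹ (P.lact x a)⁻¹
  mul_antipode_rTensor_comul := by
    classical
    refine lhom_ext fun x a => ?_
    simp only [LinearMap.comp_apply, comul_p, map_sum, LinearMap.rTensor_tmul, lift_p,
      LinearMap.mul'_apply, p_mul_p, counit_p, Algebra.linearMap_apply]
    have e : ∀ y : G, P.ract (P.ract (x * y⁻¹) (P.lact y a))⁻¹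
        (P.lact (x * y⁻¹) (P.lact y a))⁻¹ = y * x⁻¹ := by
      intro y
      rw [P.ract_inv, P.ract_ract_inv, mul_inv_rev, inv_inv]
    simp only [e, left_eq_mul, inv_eq_one]
    by_cases hx : x = 1
    · subst hx
      simp only [if_true, map_one, one_def, one_mul, ← P.mul_lact, inv_mul_cancel, P.one_lact,
        ← P.ract_inv, inv_inv]
      exact Fintype.sum_equiv (P.ractEquiv a) _ _ fun y => rfl
    · simp [hx]
  mul_antipode_lTensor_comul := by
    classical
    refine lhom_ext fun x a => ?_
    simp only [LinearMap.comp_apply, comul_p, map_sum, LinearMap.lTensor_tmul, lift_p,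
      LinearMap.mul'_apply, p_mul_p, counit_p, Algebra.linearMap_apply]
    have e : ∀ y : G, (P.ract y a)⁻¹ = P.ract (x * y⁻¹) (P.lact y a) ↔ x = 1 := by
      intro y
      rw [eq_comm, ← mul_eq_one_iff_eq_inv, ← P.mul_ract, inv_mul_cancel_right]
      constructor
      · intro h
        rw [← P.ract_ract_inv x a, h, P.one_ract]
      · rintro rfl
        exact P.one_ract a
    simp only [e, mul_inv_cancel]
    by_cases hx : x = 1
    · subst hx
      simp only [if_true, map_one, one_def, one_mul]
      exact Fintype.sum_equiv (Equiv.inv G) _ _ fun y => rfl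
    · simp [hx]

end Bismash

/-! ### Integrals and Frobenius-Schur indicators -/

/-- `Λ` is the two-sided integral of the Hopf algebra `H`, normalized by `ε(Λ) = 1`. -/
structure IsNormalizedIntegral (k : Type*) {H : Type*} [CommRing k] [Ring H] [HopfAlgebra k H]
    (Λ : H) : Prop where
  mul_left : ∀ h : H, h * Λ = CoalgebraStruct.counit (R := k) h • Λ
  mul_right : ∀ h : H, Λ * h = CoalgebraStruct.counit (R := k) h • Λ
  counit_eq_one : CoalgebraStruct.counit (R := k) Λ = 1

theorem IsNormalizedIntegral.unique {k H : Type*} [CommRing k] [Ring H] [HopfAlgebra k H]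
    {Λ Λ' : H} (h : IsNormalizedIntegral k Λ) (h' : IsNormalizedIntegral k Λ') : Λ = Λ' := by
  have h1 := h.mul_left Λ'
  have h2 := h'.mul_right Λ
  rw [h'.counit_eq_one, one_smul] at h1
  rw [h.counit_eq_one, one_smul] at h2
  exact h1.symm.trans h2

/-- The character `h ↦ Tr(π(h))` of a representation `π` of an algebra `H`. -/
noncomputable def algCharacter {k H M : Type*} [CommRing k] [Ring H] [Algebra k H]
    [AddCommGroup M] [Module k M] (π : H →ₐ[k] Module.End k M) : H →ₗ[k] k :=
  LinearMap.trace k M ∘ₗ π.toLinearMap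

open Classical in
/-- The (second) Frobenius-Schur indicator `ν(χ) = χ(∑ Λ₁ Λ₂)`, where `Λ` is the normalized
two-sided integral of the Hopf algebra `H` (which is unique; junk value `0` if there is none). -/
noncomputable def fsIndicator {k H : Type*} [CommRing k] [Ring H] [HopfAlgebra k H]
    (χ : H →ₗ[k] k) : k :=
  if h : ∃ Λ : H, IsNormalizedIntegral k Λ then
    χ (LinearMap.mul' k H (CoalgebraStruct.comul (R := k) h.choose))
  else 0

theorem fsIndicator_eq {k H : Type*} [CommRing k] [Ring H] [HopfAlgebra k H]
    (χ : H →ₗ[k] k) {Λ : H} (hΛ : IsNormalizedIntegral k Λ) :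
    fsIndicator χ = χ (LinearMap.mul' k H (CoalgebraStruct.comul (R := k) Λ)) := by
  have h : ∃ Λ : H, IsNormalizedIntegral k Λ := ⟨Λ, hΛ⟩
  rw [fsIndicator, dif_pos h, h.choose_spec.unique hΛ]

/-- The normalized integral of `k^G # kF` is `|F|⁻¹ ∑ a, p_1 # a`. -/
theorem Bismash.isNormalizedIntegral {k : Type*} [Field k] [CharZero k] {F G : Type*} [Group F]
    [Group G] [Fintype F] [Fintype G] (P : MatchedPair F G) :
    IsNormalizedIntegral k ((Fintype.card F : k)⁻¹ • ∑ a : F, Bismash.p k P 1 a) := by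
  classical
  have hl : ∀ h : Bismash k P, h * ∑ a : F, Bismash.p k P 1 a
      = CoalgebraStruct.counit (R := k) h • ∑ a : F, Bismash.p k P 1 a := by
    intro h
    have e : (Bismash.mulMap k P).flip (∑ a : F, Bismash.p k P 1 a)
        = (CoalgebraStruct.counit (R := k)).smulRight (∑ a : F, Bismash.p k P 1 a) := by
      refine Bismash.lhom_ext fun x b => ?_
      rw [LinearMap.flip_apply, map_sum, LinearMap.smulRight_apply, Bismash.counit_p]
      by_cases hx : x = 1
      · subst hx
        simp only [Bismash.mulMap_p, P.one_ract, if_true, one_smul]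
        exact Fintype.sum_equiv (Equiv.mulLeft b) _ _ fun a => rfl
      · rw [if_neg hx, zero_smul]
        refine Finset.sum_eq_zero fun a _ => ?_
        rw [Bismash.mulMap_p, if_neg]
        intro h1
        exact hx (by rw [← P.ract_ract_inv x b, ← h1, P.one_ract])
    exact congrArg (fun f => f h) e
  have hr : ∀ h : Bismash k P, (∑ a : F, Bismash.p k P 1 a) * h
      = CoalgebraStruct.counit (R := k) h • ∑ a : F, Bismash.p k P 1 a := by
    intro h
    have e : Bismash.mulMap k P (∑ a : F, Bismash.p k P 1 a)
        = (CoalgebraStruct.counit (R := k)).smulRight (∑ a : F, Bismash.p k P 1 a) := by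
      refine Bismash.lhom_ext fun x b => ?_
      rw [map_sum, LinearMap.sum_apply, LinearMap.smulRight_apply, Bismash.counit_p]
      by_cases hx : x = 1
      · subst hx
        simp only [Bismash.mulMap_p, P.one_ract, if_true, one_smul]
        exact Fintype.sum_equiv (Equiv.mulRight b) _ _ fun a => rfl
      · rw [if_neg hx, zero_smul]
        refine Finset.sum_eq_zero fun a _ => ?_
        rw [Bismash.mulMap_p, P.one_ract, if_neg hx]
    exact congrArg (fun f => f h) e
  refine ⟨fun h => ?_, fun h => ?_, ?_⟩
  · rw [mul_smul_comm, hl, smul_comm]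
  · rw [smul_mul_assoc, hr, smul_comm]
  · have hF : (Fintype.card F : k) ≠ 0 := Nat.cast_ne_zero.mpr Fintype.card_ne_zero
    simp [map_sum, Bismash.counit_p, hF]

/-! ### The `J`-module induced from a representation of a stabilizer -/

namespace Bismash

variable {k : Type*} [CommRing k] {F G : Type*} [Group F] [Group G] {P : MatchedPair F G} {x : G}
  {V : Type*} [AddCommGroup V] [Module k V]

/-- The relations `bc ⊗ v = b ⊗ cv`, `c ∈ F_x`, cutting out `kF ⊗_{kF_x} V` from `kF ⊗_k V`. -/
noncomputable def balancedRel (ρ : Representation k (P.stab x) V) : Submodule k (MonoidAlgebra k F ⊗[k] V) :=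
  Submodule.span k (Set.range fun q : F × P.stab x × V =>
    MonoidAlgebra.single (q.1 * (q.2.1 : F)) (1 : k) ⊗ₜ[k] q.2.2
      - MonoidAlgebra.single q.1 (1 : k) ⊗ₜ[k] ρ q.2.1 q.2.2)

/-- The space `kF ⊗_{kF_x} V`. -/
abbrev Induced (ρ : Representation k (P.stab x) V) : Type _ :=
  (MonoidAlgebra k F ⊗[k] V) ⧸ balancedRel ρ

/-- The element `b ⊗ v` of `kF ⊗_{kF_x} V`, for `b ∈ F`. -/
noncomputable def Induced.mk (ρ : Representation k (P.stab x) V) (b : F) (v : V) : Induced ρ :=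
  Submodule.Quotient.mk (MonoidAlgebra.single b (1 : k) ⊗ₜ[k] v)

theorem Induced.mk_mul (ρ : Representation k (P.stab x) V) (b : F) (c : P.stab x) (v : V) :
    Induced.mk ρ (b * c) v = Induced.mk ρ b (ρ c v) :=
  (Submodule.Quotient.eq _).mpr (Submodule.subset_span ⟨(b, c, v), rfl⟩)

theorem Induced.lhom_ext {ρ : Representation k (P.stab x) V} {M : Type*} [AddCommGroup M]
    [Module k M] {f g : Induced ρ →ₗ[k] M}
    (h : ∀ b v, f (Induced.mk ρ b v) = g (Induced.mk ρ b v)) : f = g := by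
  refine Submodule.linearMap_qext _ (TensorProduct.ext ?_)
  refine MonoidAlgebra.lhom_ext' fun b => LinearMap.ext_ring (LinearMap.ext fun v => ?_)
  exact h b v

open Classical in
variable (k P V x) in
/-- The map `b ⊗ v ↦ δ_{y ◁ ab, x} (ab ⊗ v)` on `kF ⊗_k V`. -/
noncomputable def preAct (y : G) (a : F) :
    MonoidAlgebra k F ⊗[k] V →ₗ[k] MonoidAlgebra k F ⊗[k] V :=
  LinearMap.rTensor V
    (Finsupp.linearCombination k (fun b : F =>
      if P.ract y (a * b) = x then MonoidAlgebra.single (a * b) (1 : k) else 0)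
      ∘ₗ (MonoidAlgebra.coeffLinearEquiv (S := k) (M := F) k).toLinearMap)

open Classical in
theorem preAct_tmul (y : G) (a b : F) (v : V) :
    preAct k P x V y a (MonoidAlgebra.single b (1 : k) ⊗ₜ[k] v) =
      if P.ract y (a * b) = x then MonoidAlgebra.single (a * b) (1 : k) ⊗ₜ[k] v else 0 := by
  simp only [preAct, LinearMap.rTensor_tmul, LinearMap.comp_apply, LinearEquiv.coe_coe]
  have : MonoidAlgebra.coeffLinearEquiv (S := k) (M := F) k (MonoidAlgebra.single b (1 : k))
      = Finsupp.single b 1 := rfl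
  rw [this, Finsupp.linearCombination_single, one_smul]
  split_ifs <;> simp

/-- The map `b ⊗ v ↦ δ_{y ◁ ab, x} (ab ⊗ v)` on `kF ⊗_{kF_x} V`. -/
noncomputable def act (ρ : Representation k (P.stab x) V) (y : G) (a : F) :
    Module.End k (Induced ρ) :=
  Submodule.mapQ (balancedRel ρ) (balancedRel ρ) (preAct k P x V y a) (by
    classical
    refine Submodule.span_le.mpr ?_
    rintro _ ⟨⟨b, c, v⟩, rfl⟩
    have hiff : P.ract y (a * (b * c)) = x ↔ P.ract y (a * b) = x := by
      rw [← mul_assoc, P.ract_mul]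
      have hc : P.ract x c = x := c.2
      have hc' : P.ract x (c : F)⁻¹ = x := (P.stab x).inv_mem c.2
      constructor
      · intro h
        rw [← P.ract_ract_inv (P.ract y (a * b)) c, h, hc']
      · intro h
        rw [h, hc]
    simp only [SetLike.mem_coe, Submodule.mem_comap, map_sub, preAct_tmul, hiff]
    split_ifs
    · exact Submodule.subset_span ⟨(a * b, c, v), by simp [mul_assoc]⟩
    · simp)

open Classical in
theorem act_mk (ρ : Representation k (P.stab x) V) (y : G) (a b : F) (v : V) :
    act ρ y a (Induced.mk ρ b v) = if P.ract y (a * b) = x then Induced.mk ρ (a * b) v else 0 := by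
  have h : act ρ y a (Induced.mk ρ b v) = Submodule.Quotient.mk
      (preAct k P x V y a (MonoidAlgebra.single b (1 : k) ⊗ₜ[k] v)) := rfl
  rw [h, preAct_tmul]
  split_ifs
  · rfl
  · rfl

/-- The `k^G # kF`-module `kF ⊗_{kF_x} V`, with action
`(p_y # a) • (b ⊗ v) = δ_{y ◁ ab, x} (ab ⊗ v)`. -/
noncomputable def inducedRep [Fintype G] (ρ : Representation k (P.stab x) V) :
    Bismash k P →ₐ[k] Module.End k (Induced ρ) :=
  AlgHom.ofLinearMap (lift k P (act ρ))
    (by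
      classical
      refine Induced.lhom_ext fun b v => ?_
      simp only [one_def, map_sum, lift_p, LinearMap.sum_apply, act_mk, one_mul, Module.End.one_apply]
      rw [Finset.sum_eq_single (P.ract x b⁻¹), if_pos (P.ract_inv_ract x b)]
      · intro y _ hy
        rw [if_neg]
        rintro h
        exact hy (by rw [← h, P.ract_ract_inv])
      · simp)
    (by
      classical
      intro u w
      have h : (mulMap k P).compr₂ (lift k P (act ρ))
          = (LinearMap.mul k (Module.End k (Induced ρ))).compl₁₂ (lift k P (act ρ))
            (lift k P (act ρ)) := by
        refine lhom_ext fun y a => lhom_ext fun z c => Induced.lhom_ext fun b v => ?_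
        simp only [LinearMap.compr₂_apply, LinearMap.compl₁₂_apply, LinearMap.mul_apply', lift_p,
          Module.End.mul_apply, mulMap_p, act_mk]
        by_cases h1 : z = P.ract y a
        · subst h1
          rw [if_pos rfl, lift_p, act_mk, ← P.ract_mul, mul_assoc]
          split_ifs with h2
          · rw [act_mk, if_pos h2]
          · rw [map_zero]
        · rw [if_neg h1, map_zero, LinearMap.zero_apply]
          split_ifs with h2
          · rw [act_mk, if_neg]
            intro h3
            apply h1
            rw [P.ract_mul, ← h2] at h3
            rw [← P.ract_ract_inv z (c * b), ← h3, P.ract_ract_inv]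
          · rw [map_zero]
      exact congrArg (fun f => f u w) h)

theorem inducedRep_p [Fintype G] (ρ : Representation k (P.stab x) V) (y : G) (a : F) :
    inducedRep ρ (p k P y a) = act ρ y a :=
  lift_p _ y a

end Bismash

/-- The one-dimensional representation of a group on `k` given by a homomorphism to `kˣ`. -/
def linearRep {k S : Type*} [CommRing k] [Group S] (ρ : S →* kˣ) : Representation k S k where
  toFun g := LinearMap.mulLeft k (ρ g : k)
  map_one' := by ext; simp
  map_mul' g h := by ext; simp

/-! ### The Hopf algebra `J_n` -/

/-- The standard `n`-cycle `a = (1 2 ⋯ n)`, as the bijection `u ↦ u + 1` of `ℤ/nℤ`. -/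
def stdCycle (n : ℕ) : Equiv.Perm (ZMod n) := Equiv.addRight 1

/-- The cyclic group `C_n = ⟨a⟩` generated by the standard `n`-cycle. -/
abbrev Cyc (n : ℕ) : Subgroup (Equiv.Perm (ZMod n)) := Subgroup.zpowers (stdCycle n)

/-- The generator `a` of `C_n`. -/
def cycGen (n : ℕ) : Cyc n := ⟨stdCycle n, Subgroup.mem_zpowers _⟩

/-- The group `S_{n-1}`: the permutations of `ℤ/nℤ` that fix `n = 0`. -/
abbrev SymPred (n : ℕ) : Subgroup (Equiv.Perm (ZMod n)) :=
  MulAction.stabilizer (Equiv.Perm (ZMod n)) (0 : ZMod n)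

noncomputable instance (n : ℕ) [NeZero n] : Fintype (SymPred n) := Fintype.ofFinite _

theorem stdCycle_zpow_apply (n : ℕ) (r : ℤ) (u : ZMod n) :
    (stdCycle n ^ r) u = u + (r : ZMod n) := by
  have hp : ∀ (m : ℕ) (v : ZMod n), (stdCycle n ^ m) v = v + (m : ZMod n) := by
    intro m
    induction m with
    | zero => simp
    | succ m ih =>
      intro v
      have h1 : stdCycle n v = v + 1 := rfl
      rw [pow_succ, Equiv.Perm.mul_apply, ih, h1, Nat.cast_succ, add_assoc, add_comm 1]
  obtain ⟨m, rfl | rfl⟩ := r.eq_nat_or_neg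
  · rw [zpow_natCast, hp, Int.cast_natCast]
  · rw [zpow_neg, zpow_natCast, Equiv.Perm.inv_eq_iff_eq, hp]
    simp

/-- `S_n = C_n S_{n-1}` and `C_n ∩ S_{n-1} = 1`. -/
theorem cyc_isComplement (n : ℕ) : (Cyc n).IsComplement' (SymPred n) := by
  have h0 : ∀ g : SymPred n, (g : Equiv.Perm (ZMod n)) 0 = 0 := fun g => g.2
  constructor
  · rintro ⟨⟨f, r, rfl⟩, g⟩ ⟨⟨f', r', rfl⟩, g'⟩ h
    have h : stdCycle n ^ r * (g : Equiv.Perm (ZMod n)) = stdCycle n ^ r' * g' := h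
    have hr : (r : ZMod n) = r' := by
      have := congrArg (fun e => e 0) h
      simpa [Equiv.Perm.mul_apply, h0, stdCycle_zpow_apply] using this
    have hf : stdCycle n ^ r = stdCycle n ^ r' := by
      ext1 u
      rw [stdCycle_zpow_apply, stdCycle_zpow_apply, hr]
    have hg : g = g' := Subtype.ext (mul_left_cancel (hf ▸ h))
    exact Prod.ext (Subtype.ext hf) hg
  · intro e
    obtain ⟨r, hr⟩ := ZMod.intCast_surjective (e 0)
    refine ⟨(⟨stdCycle n ^ r, r, rfl⟩, ⟨(stdCycle n ^ r)⁻¹ * e, ?_⟩), ?_⟩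
    · change ((stdCycle n ^ r)⁻¹ * e) 0 = 0
      rw [Equiv.Perm.mul_apply, Equiv.Perm.inv_eq_iff_eq, stdCycle_zpow_apply, hr, zero_add]
    · exact mul_inv_cancel_left _ e

/-- The matched pair `(C_n, S_{n-1})` of the factorization `S_n = C_n S_{n-1}`. -/
noncomputable def cycPair (n : ℕ) : MatchedPair (Cyc n) (SymPred n) :=
  MatchedPair.ofFactorization (Cyc n) (SymPred n) (cyc_isComplement n)

/-- The Hopf algebra `J_n = ℂ^{S_{n-1}} # ℂC_n`. -/
abbrev JAlg (n : ℕ) : Type _ := Bismash ℂ (cycPair n)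

/-! Write `F` for the acting group (here `C_n`); only its commutativity and `x⁻¹ ∈ 𝒪_x` matter until
the last step. Expanding the integral turns the indicator into a sum of character values over pairs
`(a, y)` with `y ◁ a = y⁻¹`. Inserting the induced character and moving every orbit point back to
`x` collapses this to the average, up to `1/|F_x|`, of `ρ((x ▷ b) b)` over all `b` with `x ◁ b =
x⁻¹` (`sum_involutive_pairs`, `fsIndicator_inducedRep`). These `b` form the coset `s F_x`, and `(x ▷
sh)(sh) = (x ▷ s)s · (x ▷ h)h`. The map `σ(h) = (x ▷ h)h` is an endomorphism of `F_x`
(`twistedSquare`), so the indicator is `ρ(g)`, with `g = (x ▷ s)s`, times the mean of the linear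
character `ρ ∘ σ`. It is `0` if `ρ ∘ σ` is nontrivial and `ρ(g)` otherwise. Since `x ▷ g = g`, one
has `σ(g) = g²`, which forces `ρ(g)² = 1` in the second case (`extendChar_sq_eq_one`). For `C_n`, an
element is determined by its value at `0`, and `(x ▷ a^r) a^r` sends `0` to `x(r) + r`. Hence
`σ(a^t) = a^(u₁ t)` and `g = a^(u₂ t)`, which yields the powers of `ζ`. -/

namespace Bismash

/-! ### Characters of induced modules. -/

section Trace

variable {k F G : Type*} [Field k] [Group F] [Group G] {P : MatchedPair F G} {x : G}

open Classical in
/-- The extension of a linear character of the stabilizer `F_x` to `F` by zero. -/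
noncomputable def extendChar (ρ : P.stab x →* kˣ) (a : F) : k :=
  if h : a ∈ P.stab x then (ρ ⟨a, h⟩ : k) else 0

theorem extendChar_coe (ρ : P.stab x →* kˣ) (c : P.stab x) :
    extendChar ρ (c : F) = ρ c := by
  rw [extendChar, dif_pos c.2]

theorem extendChar_mul_coe (ρ : P.stab x →* kˣ) (a : F) (c : P.stab x) :
    extendChar ρ (a * c) = extendChar ρ a * ρ c := by
  by_cases ha : a ∈ P.stab x
  · lift a to P.stab x using ha
    rw [← Subgroup.coe_mul, extendChar_coe, extendChar_coe, map_mul, Units.val_mul]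
  · have h : a * c ∉ P.stab x := fun h => ha (by
      simpa using (P.stab x).mul_mem h ((P.stab x).inv_mem c.2))
    rw [extendChar, dif_neg h, extendChar, dif_neg ha, zero_mul]

/-- The map `b ⊗ v ↦ (d ↦ ρ(d⁻¹ b) v)` from the induced module to the functions on `F`. -/
noncomputable def inducedToFun (ρ : P.stab x →* kˣ) :
    Induced (linearRep ρ) →ₗ[k] (F → k) :=
  (balancedRel (linearRep ρ)).liftQ
    (TensorProduct.lift ((Finsupp.linearCombination k (fun b : F =>
      LinearMap.toSpanSingleton k (F → k) fun d => extendChar ρ (d⁻¹ * b)))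
      ∘ₗ (MonoidAlgebra.coeffLinearEquiv (S := k) (M := F) k).toLinearMap)) (by
    refine Submodule.span_le.mpr ?_
    rintro _ ⟨⟨b, c, v⟩, rfl⟩
    have e : ∀ b : F, MonoidAlgebra.coeffLinearEquiv (S := k) (M := F) k
      (MonoidAlgebra.single b (1 : k)) = Finsupp.single b 1 := fun _ => rfl
    simp only [SetLike.mem_coe, LinearMap.mem_ker, map_sub, TensorProduct.lift.tmul,
      LinearMap.comp_apply, LinearEquiv.coe_coe, e, Finsupp.linearCombination_single, one_smul,
      LinearMap.toSpanSingleton_apply]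
    ext d
    have : linearRep ρ c v = (ρ c : k) * v := rfl
    simp only [← mul_assoc, Pi.sub_apply, Pi.smul_apply, smul_eq_mul, Pi.zero_apply, this,
      extendChar_mul_coe]
    ring)

theorem inducedToFun_mk (ρ : P.stab x →* kˣ) (b : F) (v : k) (d : F) :
    inducedToFun ρ (Induced.mk (linearRep ρ) b v) d = v * extendChar ρ (d⁻¹ * b) := by
  have e : MonoidAlgebra.coeffLinearEquiv (S := k) (M := F) k
      (MonoidAlgebra.single b (1 : k)) = Finsupp.single b 1 := rfl
  have h : inducedToFun ρ (Induced.mk (linearRep ρ) b v) =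
    TensorProduct.lift ((Finsupp.linearCombination k (fun b : F =>
      LinearMap.toSpanSingleton k (F → k) fun d => extendChar ρ (d⁻¹ * b)))
      ∘ₗ (MonoidAlgebra.coeffLinearEquiv (S := k) (M := F) k).toLinearMap)
      (MonoidAlgebra.single b (1 : k) ⊗ₜ[k] v) := rfl
  rw [h]
  simp [e]

theorem Induced.mk_eq_smul (ρ : P.stab x →* kˣ) (b : F) (v : k) :
    Induced.mk (linearRep ρ) b v = v • Induced.mk (linearRep ρ) b 1 := by
  rw [Induced.mk, Induced.mk, ← Submodule.Quotient.mk_smul, ← TensorProduct.tmul_smul,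
    smul_eq_mul, mul_one]

theorem Induced.mk_mul_coe (ρ : P.stab x →* kˣ) (b : F) (c : P.stab x) :
    Induced.mk (linearRep ρ) (b * c) 1 = (ρ c : k) • Induced.mk (linearRep ρ) b 1 := by
  rw [Induced.mk_mul, Induced.mk_eq_smul]
  congr 1
  exact mul_one _

variable [Fintype F]

/-- The map `f ↦ ∑ b, f(b) (b ⊗ 1)` from the functions on `F` to the induced module. -/
noncomputable def funToInduced (ρ : P.stab x →* kˣ) :
    (F → k) →ₗ[k] Induced (linearRep ρ) :=
  Fintype.linearCombination k fun b => Induced.mk (linearRep ρ) b 1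

/-- Each element of the coset `b F_x` contributes the same vector, because the factor `ρ(d⁻¹)`
cancels the `ρ(d)` gained by moving `d` across the tensor sign. After division by `|F_x|` the
induced module becomes a direct summand of the functions on `F`, so traces can be computed without
choosing coset representatives. -/
theorem funToInduced_inducedToFun (ρ : P.stab x →* kˣ) (m : Induced (linearRep ρ)) :
    funToInduced ρ (inducedToFun ρ m) = (Nat.card (P.stab x) : k) • m := by
  classical
  have h : funToInduced ρ ∘ₗ inducedToFun ρ
      = (Nat.card (P.stab x) : k) • (LinearMap.id : Induced (linearRep ρ) →ₗ[k] _) := by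
    refine Induced.lhom_ext fun b v => ?_
    simp only [LinearMap.comp_apply, funToInduced, Fintype.linearCombination_apply,
      inducedToFun_mk, LinearMap.smul_apply, LinearMap.id_apply]
    have key : ∀ d : F, (v * extendChar ρ ((b * d)⁻¹ * b)) • Induced.mk (linearRep ρ) (b * d) 1
        = if d ∈ P.stab x then Induced.mk (linearRep ρ) b v else 0 := by
      intro d
      have e : (b * d)⁻¹ * b = d⁻¹ := by group
      rw [e]
      split_ifs with hd
      · lift d to P.stab x using hd
        rw [← Subgroup.coe_inv, extendChar_coe, Induced.mk_mul_coe, smul_smul,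
          Induced.mk_eq_smul ρ b v, mul_assoc, ← Units.val_mul, ← map_mul, inv_mul_cancel,
          map_one, Units.val_one, mul_one]
      · rw [extendChar, dif_neg (by simpa using hd), mul_zero, zero_smul]
    rw [← Equiv.sum_comp (Equiv.mulLeft b)]
    simp only [Equiv.coe_mulLeft, key]
    rw [← Finset.sum_filter, Finset.sum_const, ← Nat.cast_smul_eq_nsmul k]
    congr 2
    rw [Nat.card_eq_fintype_card, Fintype.card_subtype]
  exact congrArg (fun f => f m) h

instance (ρ : P.stab x →* kˣ) : Module.Finite k (Induced (linearRep ρ)) := by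
  have : Module.Finite k (MonoidAlgebra k F) :=
    Module.Finite.equiv (MonoidAlgebra.coeffLinearEquiv (S := k) (M := F) k).symm
  infer_instance

open Classical in
/-- The character of the induced module at `p_z # a`. -/
theorem trace_act [CharZero k] (ρ : P.stab x →* kˣ) (z : G) (a : F) :
    LinearMap.trace k _ (act (linearRep ρ) z a) = (Nat.card (P.stab x) : k)⁻¹ *
      ∑ b : F, if P.ract z (a * b) = x then extendChar ρ (b⁻¹ * a * b) else 0 := by
  have hS : (Nat.card (P.stab x) : k) ≠ 0 := Nat.cast_ne_zero.mpr Nat.card_pos.ne'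
  have h1 : (Nat.card (P.stab x) : k) • act (linearRep ρ) z a
      = act (linearRep ρ) z a ∘ₗ (funToInduced ρ ∘ₗ inducedToFun ρ) := by
    refine LinearMap.ext fun m => ?_
    rw [LinearMap.comp_apply, LinearMap.comp_apply, funToInduced_inducedToFun, map_smul,
      LinearMap.smul_apply]
  -- Cyclicity of the trace moves the computation to `F → k`, where the standard basis gives the
  -- diagonal entries.
  rw [eq_inv_mul_iff_mul_eq₀ hS, ← smul_eq_mul, ← map_smul, h1, ← LinearMap.comp_assoc,
    LinearMap.trace_comp_comm', LinearMap.trace_eq_matrix_trace k (Pi.basisFun k F),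
    Matrix.trace]
  refine Finset.sum_congr rfl fun b _ => ?_
  have h2 : funToInduced ρ (Pi.single b 1) = Induced.mk (linearRep ρ) b 1 := by
    simp [funToInduced]
  rw [Matrix.diag_apply, LinearMap.toMatrix_apply, Pi.basisFun_apply, Pi.basisFun_repr,
    LinearMap.comp_apply, LinearMap.comp_apply, h2, act_mk]
  split_ifs
  · rw [inducedToFun_mk, one_mul, mul_assoc]
  · simp

end Trace

/-! ### The indicator as an average over the stabilizer. -/

section Indicator

variable {k F G : Type*} [Field k] [CharZero k] [Group F] [Group G] [Fintype F] [Fintype G]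
  {P : MatchedPair F G} {x : G}

-- In `Λ₁ Λ₂` the `y`-term `(p_{y⁻¹} # (y ▷ a))(p_y # a)` survives only if `y = y⁻¹ ◁ (y ▷ a)`, and
-- the right side is `(y ◁ a)⁻¹`.
open Classical in
theorem fsIndicator_eq_sum (χ : Bismash k P →ₗ[k] k) :
    fsIndicator χ = (Fintype.card F : k)⁻¹ *
      ∑ a : F, ∑ y : G, if y = (P.ract y a)⁻¹ then χ (p k P y⁻¹ (P.lact y a * a)) else 0 := by
  rw [fsIndicator_eq χ (isNormalizedIntegral P)]
  simp only [map_smul, map_sum, comul_p, LinearMap.mul'_apply, p_mul_p, one_mul, ← P.ract_inv,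
    smul_eq_mul, apply_ite χ, map_zero]

-- If `y ◁ a = y⁻¹`, then acting on `y⁻¹` by `(y ▷ a)a` leads to `y` and back to `y⁻¹`. The inner
-- condition is therefore `y⁻¹ ◁ c = x`, which pins `y` to one orbit point `y₀`; transporting `y₀`
-- back to `x` removes all dependence on `c`.
omit [CharZero k] in
open Classical in
theorem sum_involutive_pairs (hF : ∀ a b : F, a * b = b * a) {s : F} (hs : x⁻¹ = P.ract x s)
    (f : F → k) (c : F) :
    (∑ a : F, ∑ y : G, if y = (P.ract y a)⁻¹ then
        if P.ract y⁻¹ (P.lact y a * a * c) = x then f (P.lact y a * a) else 0 else 0)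
      = ∑ b : F, if x⁻¹ = P.ract x b then f (P.lact x b * b) else 0 := by
  -- `e` carries `x` to the required `y₀ = (x ◁ c⁻¹)⁻¹ = x⁻¹ ◁ (x ▷ c⁻¹)`, using `x⁻¹ = x ◁ s`.
  set e := s * P.lact x c⁻¹ with he
  set y₀ := P.ract x e with hy₀
  have hy₀' : y₀⁻¹ = P.ract x c⁻¹ := by
    rw [inv_eq_iff_eq_inv, P.ract_inv, hs, hy₀, he, P.ract_mul]
  have cond : ∀ (a : F) (y : G), y = (P.ract y a)⁻¹ →
      (P.ract y⁻¹ (P.lact y a * a * c) = x ↔ y = y₀) := by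
    intro a y hy
    have h1 : P.ract y⁻¹ (P.lact y a * a * c) = P.ract y⁻¹ c := by
      rw [P.ract_mul, P.ract_mul, ← P.ract_inv, ← hy]
      congr 1
      exact (inv_eq_iff_eq_inv.mpr hy).symm
    rw [h1, ← inv_inj (a := y), hy₀']
    constructor
    · rintro h
      rw [← h, P.ract_ract_inv]
    · intro h
      rw [h, P.ract_inv_ract]
  have h1 : ∀ a : F, (∑ y : G, if y = (P.ract y a)⁻¹ then
        if P.ract y⁻¹ (P.lact y a * a * c) = x then f (P.lact y a * a) else 0 else 0)
      = if y₀ = (P.ract y₀ a)⁻¹ then f (P.lact y₀ a * a) else 0 := by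
    intro a
    rw [Finset.sum_eq_single y₀]
    · split_ifs with h2 h3
      · rfl
      · exact absurd ((cond a y₀ h2).mpr rfl) h3
      · rfl
    · intro y _ hy
      split_ifs with h2 h3
      · exact absurd ((cond a y h2).mp h3) hy
      · rfl
      · rfl
    · simp
  rw [Finset.sum_congr rfl fun a _ => h1 a]
  symm
  -- The substitution is `a = e⁻¹ b (x ▷ e)`: from `y₀` go back to `x`, apply `b` to reach `x⁻¹`,
  -- then use that `x ▷ e` takes `x⁻¹` to `(x ◁ e)⁻¹ = y₀⁻¹`.
  refine Fintype.sum_equiv ((Equiv.mulLeft e⁻¹).trans (Equiv.mulRight (P.lact x e))) _ _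
    fun b => ?_
  simp only [Equiv.trans_apply, Equiv.coe_mulLeft, Equiv.coe_mulRight]
  have h2 : P.ract y₀ (e⁻¹ * b * P.lact x e) = P.ract (P.ract x b) (P.lact x e) := by
    rw [hy₀, ← P.ract_mul, ← P.ract_mul]
    congr 1
    group
  have h3 : y₀ = (P.ract y₀ (e⁻¹ * b * P.lact x e))⁻¹ ↔ x⁻¹ = P.ract x b := by
    rw [← inv_eq_iff_eq_inv, h2, hy₀, P.ract_inv]
    exact (P.ractEquiv (P.lact x e)).injective.eq_iff
  simp only [h3]
  refine if_ctx_congr Iff.rfl (fun hb => ?_) fun _ => rfl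
  -- Both sides equal `x ▷ (b (x ▷ e))`; on the right, `x ◁ b = x⁻¹` undoes the inner `x ▷`.
  have h4 : P.lact x e * P.lact y₀ (e⁻¹ * b * P.lact x e) = P.lact x b * e := by
    rw [hy₀, ← P.lact_mul, mul_assoc e⁻¹, mul_inv_cancel_left, P.lact_mul, ← hb, ← P.mul_lact,
      inv_mul_cancel, P.one_lact]
  congr 1
  calc P.lact x b * b = (P.lact x b * e) * (e⁻¹ * b) := by group
    _ = P.lact y₀ (e⁻¹ * b * P.lact x e) * (P.lact x e * (e⁻¹ * b)) := by
      rw [← h4, hF (P.lact x e), mul_assoc]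
    _ = _ := by rw [hF (P.lact x e)]

/-- The Frobenius-Schur indicator of a module induced from a linear character, as an average over
the stabilizer. -/
theorem fsIndicator_inducedRep (hF : ∀ a b : F, a * b = b * a) {s : F}
    (hs : x⁻¹ = P.ract x s) (ρ : P.stab x →* kˣ) [Fintype (P.stab x)] :
    fsIndicator (algCharacter (inducedRep (linearRep ρ))) = (Nat.card (P.stab x) : k)⁻¹ *
      ∑ h : P.stab x, extendChar ρ (P.lact x (s * h) * (s * h)) := by
  classical
  have hFc : (Fintype.card F : k) ≠ 0 := Nat.cast_ne_zero.mpr Fintype.card_ne_zero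
  have hconj : ∀ a b : F, b⁻¹ * a * b = a := fun a b => by
    rw [hF b⁻¹, inv_mul_cancel_right]
  have hχ : ∀ (z : G) (a : F), algCharacter (inducedRep (linearRep ρ)) (p k P z a)
      = (Nat.card (P.stab x) : k)⁻¹ *
        ∑ c : F, if P.ract z (a * c) = x then extendChar ρ a else 0 := by
    intro z a
    have : algCharacter (inducedRep (linearRep ρ)) (p k P z a)
      = LinearMap.trace k _ (inducedRep (linearRep ρ) (p k P z a)) := rfl
    rw [this, inducedRep_p, trace_act]
    simp only [hconj]
  rw [fsIndicator_eq_sum]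
  have h1 : (∑ a : F, ∑ y : G, if y = (P.ract y a)⁻¹ then
        algCharacter (inducedRep (linearRep ρ)) (p k P y⁻¹ (P.lact y a * a)) else 0)
      = (Nat.card (P.stab x) : k)⁻¹ * ∑ c : F, ∑ a : F, ∑ y : G, if y = (P.ract y a)⁻¹ then
        if P.ract y⁻¹ (P.lact y a * a * c) = x then extendChar ρ (P.lact y a * a) else 0
        else 0 := by
    have h2 : ∀ (a : F) (y : G), (if y = (P.ract y a)⁻¹ then
          algCharacter (inducedRep (linearRep ρ)) (p k P y⁻¹ (P.lact y a * a)) else 0)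
        = (Nat.card (P.stab x) : k)⁻¹ * ∑ c : F, if y = (P.ract y a)⁻¹ then
          if P.ract y⁻¹ (P.lact y a * a * c) = x then extendChar ρ (P.lact y a * a) else 0
          else 0 := by
      intro a y
      split_ifs
      · exact hχ _ _
      · simp
    simp only [h2, ← Finset.mul_sum]
    congr 1
    conv_rhs => rw [Finset.sum_comm]
    exact Finset.sum_congr rfl fun a _ => Finset.sum_comm
  rw [h1]
  -- The summand no longer involves `c`, so the sum over `c` gives a factor `|F|` that cancels the
  -- normalization of the integral.
  simp only [sum_involutive_pairs hF hs]
  rw [Finset.sum_const, Finset.card_univ, nsmul_eq_mul, mul_left_comm, inv_mul_cancel_left₀ hFc]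
  congr 1
  rw [← Equiv.sum_comp (Equiv.mulLeft s), ← Finset.sum_filter]
  -- The elements taking `x` to `x⁻¹` form the coset `s F_x`.
  have hcond : ∀ b : F, x⁻¹ = P.ract x (s * b) ↔ b ∈ P.stab x := by
    intro b
    rw [hF s b, P.ract_mul, hs, P.mem_stab]
    exact ⟨fun h => ((P.ractEquiv s).injective h).symm, fun h => by rw [h]⟩
  refine Finset.sum_bij' (fun b hb => ⟨b, (hcond b).mp (Finset.mem_filter.mp hb).2⟩) (fun h _ => h)
    ?_ ?_ ?_ ?_ ?_
  · simp
  · intro h _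
    simp [hcond]
  all_goals simp

end Indicator

end Bismash

/-! ### The twisted squaring map on the stabilizer. -/

namespace MatchedPair

variable {F G : Type*} [Group F] [Group G] (P : MatchedPair F G) {x : G}

/-- Everything follows from `x⁻¹ ◁ (x ▷ b) = (x ◁ b)⁻¹`. If `x ◁ b = x⁻¹`, then `b` followed by `x ▷
b` takes `x` to `x⁻¹` and back. If `b` fixes `x`, then `x ▷ b` fixes `x⁻¹`, hence also `x`: in a
commutative group, points of one orbit have equal stabilizers. -/
theorem lact_mul_self_mem_stab (hF : ∀ a b : F, a * b = b * a) {s b : F}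
    (hs : x⁻¹ = P.ract x s) (hb : x⁻¹ = P.ract x b ∨ b ∈ P.stab x) :
    P.lact x b * b ∈ P.stab x := by
  rw [hF]
  have h1 := P.ract_inv x b
  rw [P.mem_stab, P.ract_mul]
  rcases hb with hb | hb
  · rw [← hb, inv_inv] at h1
    rw [← hb]
    exact h1.symm
  · rw [P.mem_stab.mp hb] at h1 ⊢
    refine (P.ractEquiv s).injective ?_
    change P.ract (P.ract x _) s = P.ract x s
    rw [← P.ract_mul, hF, P.ract_mul, ← hs, ← h1]

/-- The homomorphism `h ↦ (x ▷ h) h` of the stabilizer `F_x`, for `F` commutative and `x⁻¹` in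
the orbit of `x`. -/
def twistedSquare (hF : ∀ a b : F, a * b = b * a) {s : F} (hs : x⁻¹ = P.ract x s) :
    P.stab x →* P.stab x where
  toFun h := ⟨P.lact x h * h, P.lact_mul_self_mem_stab hF hs (Or.inr h.2)⟩
  map_one' := Subtype.ext (by simp [P.lact_one])
  map_mul' g h := Subtype.ext (by
    have hg : P.ract x g = x := g.2
    simp only [Subgroup.coe_mul, P.lact_mul, hg]
    rw [mul_assoc, mul_assoc, ← mul_assoc _ (g : F), ← mul_assoc (g : F), hF (P.lact x h)])

/-- In `x ▷ (s (x ▷ s))` the second factor is `x⁻¹ ▷ (x ▷ s) = s`. This is what makes the twisted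
square of `(x ▷ s)s` its ordinary square. -/
theorem lact_lact_mul_self (hF : ∀ a b : F, a * b = b * a) {s : F} (hs : x⁻¹ = P.ract x s) :
    P.lact x (P.lact x s * s) = P.lact x s * s := by
  rw [hF, P.lact_mul, ← hs, ← P.mul_lact, inv_mul_cancel, P.one_lact, hF]

end MatchedPair

/-! ### Evaluation by orthogonality of characters. -/

namespace Bismash

variable {k F G : Type*} [Field k] [CharZero k] [Group F] [Group G] [Fintype F] [Fintype G]
  {P : MatchedPair F G} {x : G}

/-- Writing `sh = hs` and using `x ◁ h = x` splits `x ▷ (hs)` as `(x ▷ h)(x ▷ s)`, so the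
contribution of the representative `s` factors out. -/
theorem fsIndicator_inducedRep_eq_mul (hF : ∀ a b : F, a * b = b * a) {s : F}
    (hs : x⁻¹ = P.ract x s) (ρ : P.stab x →* kˣ) [Fintype (P.stab x)] :
    fsIndicator (algCharacter (inducedRep (linearRep ρ))) = (Nat.card (P.stab x) : k)⁻¹ *
      (extendChar ρ (P.lact x s * s) * ∑ h : P.stab x, (ρ (P.twistedSquare hF hs h) : k)) := by
  rw [fsIndicator_inducedRep hF hs, Finset.mul_sum (a := extendChar ρ _)]
  congr 1
  refine Finset.sum_congr rfl fun h _ => ?_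
  have hh : P.ract x h = x := h.2
  rw [← extendChar_mul_coe]
  congr 1
  change _ = P.lact x s * s * (P.lact x h * h)
  rw [hF s, P.lact_mul, hh, hF (P.lact x h), mul_assoc, mul_assoc, ← mul_assoc _ (h : F),
    hF (P.lact x h * h)]

theorem fsIndicator_inducedRep_eq_zero (hF : ∀ a b : F, a * b = b * a) {s : F}
    (hs : x⁻¹ = P.ract x s) (ρ : P.stab x →* kˣ) (hρ : ρ.comp (P.twistedSquare hF hs) ≠ 1) :
    fsIndicator (algCharacter (inducedRep (linearRep ρ))) = 0 := by
  classical
  rw [fsIndicator_inducedRep_eq_mul hF hs]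
  -- A nontrivial linear character of a finite group sums to zero.
  have h := sum_hom_units_eq_zero ((Units.coeHom k).comp (ρ.comp (P.twistedSquare hF hs)))
    (fun h => hρ (MonoidHom.ext fun g => Units.ext (DFunLike.congr_fun h g)))
  have h' : ∑ h : P.stab x, (ρ (P.twistedSquare hF hs h) : k) = 0 := h
  rw [h', mul_zero, mul_zero]

theorem fsIndicator_inducedRep_eq_extendChar (hF : ∀ a b : F, a * b = b * a) {s : F}
    (hs : x⁻¹ = P.ract x s) (ρ : P.stab x →* kˣ) (hρ : ρ.comp (P.twistedSquare hF hs) = 1) :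
    fsIndicator (algCharacter (inducedRep (linearRep ρ))) = extendChar ρ (P.lact x s * s) := by
  classical
  have hS : (Nat.card (P.stab x) : k) ≠ 0 := Nat.cast_ne_zero.mpr Nat.card_pos.ne'
  rw [fsIndicator_inducedRep_eq_mul hF hs]
  have h : ∀ h : P.stab x, (ρ (P.twistedSquare hF hs h) : k) = 1 := fun h =>
    congrArg Units.val (DFunLike.congr_fun hρ h)
  simp only [h]
  rw [Finset.sum_const, Finset.card_univ, nsmul_one, ← Nat.card_eq_fintype_card,
    mul_comm (extendChar _ _), inv_mul_cancel_left₀ hS]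

omit [CharZero k] [Fintype F] [Fintype G] in
theorem extendChar_sq_eq_one (hF : ∀ a b : F, a * b = b * a) {s : F}
    (hs : x⁻¹ = P.ract x s) (ρ : P.stab x →* kˣ) (hρ : ρ.comp (P.twistedSquare hF hs) = 1) :
    extendChar ρ (P.lact x s * s) ^ 2 = 1 := by
  let g : P.stab x := ⟨P.lact x s * s, P.lact_mul_self_mem_stab hF hs (Or.inl hs)⟩
  have hg : P.twistedSquare hF hs g = g * g :=
    Subtype.ext (congrArg (· * (g : F)) (P.lact_lact_mul_self hF hs))
  have h : ρ (P.twistedSquare hF hs g) = 1 := DFunLike.congr_fun hρ g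
  have e : extendChar ρ (P.lact x s * s) = ρ g := extendChar_coe ρ g
  rw [e, sq, ← Units.val_mul, ← map_mul, ← hg, h, Units.val_one]

end Bismash

/-! ### Explicit computation in `C_n`. -/

theorem cycPair_lact_apply_zero (n : ℕ) (x : SymPred n) (b : Cyc n) :
    ((cycPair n).lact x b : Equiv.Perm (ZMod n)) 0
      = (x : Equiv.Perm (ZMod n)) ((b : Equiv.Perm (ZMod n)) 0) := by
  have h := congrArg (fun e : Equiv.Perm (ZMod n) => e 0)
    (MatchedPair.ofFactorization_spec (Cyc n) (SymPred n) (cyc_isComplement n) x b)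
  have h0 : (((cycPair n).ract x b : SymPred n) : Equiv.Perm (ZMod n)) 0 = 0 :=
    ((cycPair n).ract x b).2
  change ((cycPair n).lact x b : Equiv.Perm (ZMod n))
    ((((cycPair n).ract x b : SymPred n) : Equiv.Perm (ZMod n)) 0) = _ at h
  rwa [h0] at h

theorem coe_cycGen_zpow_apply (n : ℕ) (r : ℤ) (u : ZMod n) :
    ((cycGen n ^ r : Cyc n) : Equiv.Perm (ZMod n)) u = u + (r : ZMod n) := by
  rw [← stdCycle_zpow_apply]
  rfl

theorem Cyc.coe_apply (n : ℕ) (b : Cyc n) (u : ZMod n) :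
    (b : Equiv.Perm (ZMod n)) u = u + (b : Equiv.Perm (ZMod n)) 0 := by
  obtain ⟨_, r, rfl⟩ := b
  change (stdCycle n ^ r) u = u + (stdCycle n ^ r) 0
  rw [stdCycle_zpow_apply, stdCycle_zpow_apply, zero_add]

theorem Cyc.ext_zero {n : ℕ} {b c : Cyc n}
    (h : (b : Equiv.Perm (ZMod n)) 0 = (c : Equiv.Perm (ZMod n)) 0) : b = c :=
  Subtype.ext (Equiv.ext fun u => by rw [Cyc.coe_apply, h, ← Cyc.coe_apply])

theorem Cyc.mul_comm (n : ℕ) (a b : Cyc n) : a * b = b * a :=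
  Subtype.ext (setLike_mul_comm a.2 b.2)

theorem cycPair_lact_mul_self_apply_zero (n : ℕ) (x : SymPred n) (r : ℤ) :
    (((cycPair n).lact x (cycGen n ^ r) * cycGen n ^ r : Cyc n) : Equiv.Perm (ZMod n)) 0
      = (x : Equiv.Perm (ZMod n)) (r : ZMod n) + (r : ZMod n) := by
  rw [Subgroup.coe_mul, Equiv.Perm.mul_apply, Cyc.coe_apply, cycPair_lact_apply_zero,
    coe_cycGen_zpow_apply, zero_add, add_comm]

/-- Translations are compared through their values at `0`. This is the dictionary between the
congruences for `u₁`, `u₂` and identities in `C_n`; it is used with `r = t` and `r = s`. -/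
theorem cycPair_lact_mul_self_eq_zpow_iff (n t : ℕ) (x : SymPred n) (r u : ℤ) :
    (cycPair n).lact x (cycGen n ^ r) * cycGen n ^ r = (cycGen n ^ t) ^ u ↔
      (x : Equiv.Perm (ZMod n)) (r : ZMod n) + (r : ZMod n) = (u : ZMod n) * (t : ZMod n) := by
  have h : (((cycGen n ^ t) ^ u : Cyc n) : Equiv.Perm (ZMod n)) 0
      = (u : ZMod n) * (t : ZMod n) := by
    rw [← zpow_natCast, ← zpow_mul, coe_cycGen_zpow_apply]
    push_cast
    ring
  rw [← cycPair_lact_mul_self_apply_zero, ← h]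
  exact ⟨fun e => by rw [e], Cyc.ext_zero⟩

/-- The congruences modulo `n` are stated as equalities in `ZMod n`. The representation enters as
any `ρ` with the prescribed value at `a^t`, which determines it because `a^t` generates `F_x`. -/
theorem mainTheorem1 (n : ℕ) [NeZero n] (x : SymPred n) (t : ℕ) (s : ℤ)
    (htn : t ∣ n)
    (hstab : (cycPair n).stab x = Subgroup.zpowers (cycGen n ^ t))
    (hinv : x⁻¹ = (cycPair n).ract x (cycGen n ^ s)) :
    (∃ u₁ : ℤ, (x : Equiv.Perm (ZMod n)) (t : ZMod n) + (t : ZMod n) = (u₁ : ZMod n) * (t : ZMod n)) ∧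
    (∃ u₂ : ℤ, (x : Equiv.Perm (ZMod n)) (s : ZMod n) + (s : ZMod n) = (u₂ : ZMod n) * (t : ZMod n)) ∧
    ∀ (ζ : ℂ) (_hζ : IsPrimitiveRoot ζ (n / t)) (i : ℤ)
      (ρ : (cycPair n).stab x →* ℂˣ)
      (_hρ : ∀ g : (cycPair n).stab x, (g : Cyc n) = cycGen n ^ t → (ρ g : ℂ) = ζ ^ i)
      (u₁ u₂ : ℤ)
      (_hu₁ : (x : Equiv.Perm (ZMod n)) (t : ZMod n) + (t : ZMod n) = (u₁ : ZMod n) * (t : ZMod n))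
      (_hu₂ : (x : Equiv.Perm (ZMod n)) (s : ZMod n) + (s : ZMod n) = (u₂ : ZMod n) * (t : ZMod n)),
      (ζ ^ (i * u₁) ≠ 1 → fsIndicator (algCharacter (Bismash.inducedRep (linearRep ρ))) = 0) ∧
      (ζ ^ (i * u₁) = 1 →
        (Odd (n / t) → fsIndicator (algCharacter (Bismash.inducedRep (linearRep ρ))) = 1) ∧
        (Even (n / t) →
          fsIndicator (algCharacter (Bismash.inducedRep (linearRep ρ))) = ζ ^ (-(i * u₂)) ∧
          (ζ ^ (-(i * u₂)) = 1 ∨ ζ ^ (-(i * u₂)) = -1))) := by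
  have : Fintype (Cyc n) := Fintype.ofFinite _
  have hF := Cyc.mul_comm n
  have hgt : cycGen n ^ t ∈ (cycPair n).stab x := hstab ▸ Subgroup.mem_zpowers _
  have ht := (cycPair n).lact_mul_self_mem_stab hF hinv (Or.inr hgt)
  have hs := (cycPair n).lact_mul_self_mem_stab hF hinv (Or.inl hinv)
  have hiff := cycPair_lact_mul_self_eq_zpow_iff n t x
  have hiff_t : ∀ u : ℤ, (cycPair n).lact x (cycGen n ^ t) * cycGen n ^ t = (cycGen n ^ t) ^ u ↔
      (x : Equiv.Perm (ZMod n)) (t : ZMod n) + (t : ZMod n) = (u : ZMod n) * (t : ZMod n) := by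
    intro u
    have h := hiff t u
    rwa [zpow_natCast, Int.cast_natCast] at h
  refine ⟨?_, ?_, ?_⟩
  · rw [hstab] at ht
    obtain ⟨u, hu⟩ := ht
    exact ⟨u, (hiff_t u).mp hu.symm⟩
  · rw [hstab] at hs
    obtain ⟨u, hu⟩ := hs
    exact ⟨u, (hiff s u).mp hu.symm⟩
  · intro ζ hζ i ρ hρ u₁ u₂ hu₁ hu₂
    let g : (cycPair n).stab x := ⟨cycGen n ^ t, hgt⟩
    have hρg : ∀ u : ℤ, (ρ (g ^ u) : ℂ) = ζ ^ (i * u) := by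
      intro u
      rw [map_zpow, Units.val_zpow_eq_zpow_val, hρ g rfl, zpow_mul]
    have hgu : (cycPair n).twistedSquare hF hinv g = g ^ u₁ :=
      Subtype.ext ((hiff_t u₁).mpr hu₁)
    -- Triviality can be tested on the generator `g = a^t`, where the twisted square is `g ^ u₁`.
    have hψ : ρ.comp ((cycPair n).twistedSquare hF hinv) = 1 ↔ ζ ^ (i * u₁) = 1 := by
      rw [← hρg, ← hgu, Units.val_eq_one]
      refine ⟨fun h => DFunLike.congr_fun h g, fun h => MonoidHom.ext fun b => ?_⟩
      obtain ⟨r, hr⟩ := (hstab ▸ b.2 : (b : Cyc n) ∈ Subgroup.zpowers (cycGen n ^ t))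
      have hb : b = g ^ r := Subtype.ext hr.symm
      rw [hb, map_zpow, MonoidHom.comp_apply, h, one_zpow, MonoidHom.one_apply]
    have hext : Bismash.extendChar ρ ((cycPair n).lact x (cycGen n ^ s) * cycGen n ^ s)
        = ζ ^ (i * u₂) := by
      rw [← hρg, (hiff s u₂).mpr hu₂]
      exact Bismash.extendChar_coe ρ (g ^ u₂)
    refine ⟨fun h => Bismash.fsIndicator_inducedRep_eq_zero hF hinv ρ (mt hψ.mp h), fun h => ?_⟩
    have hsq := Bismash.extendChar_sq_eq_one hF hinv ρ (hψ.mpr h)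
    rw [Bismash.fsIndicator_inducedRep_eq_extendChar hF hinv ρ (hψ.mpr h), hext]
    rw [hext] at hsq
    refine ⟨fun hodd => ?_, fun _ => ⟨?_, ?_⟩⟩
    -- The value squares to `1` and is also an `n/t`-th root of unity; for odd `n/t` it must be `1`.
    · obtain ⟨m, hm⟩ := hodd
      have h1 : (ζ ^ (i * u₂)) ^ (n / t) = 1 := by
        rw [← zpow_natCast, ← zpow_mul, _root_.mul_comm, zpow_mul, zpow_natCast, hζ.pow_eq_one,
          one_zpow]
      rwa [hm, pow_succ, pow_mul, hsq, one_pow, one_mul] at h1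
    -- The computed value is `ζ ^ (i * u₂)`; since its square is `1`, it equals its inverse, so the
    -- sign of the exponent does not matter.
    · rw [zpow_neg]
      exact eq_inv_of_mul_eq_one_left (by rwa [← sq])
    · rw [zpow_neg, ← sq_eq_one_iff, inv_pow, hsq, inv_one]
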